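/- Let $n\ge 1$, $s\in(0,1)$, $1<\lambda\le\Lambda<\infty$. Let $g\colon\mathbb R\to\mathbb R$ be odd, with $g>0$, $g$ nondecreasing and convex on $(0,\infty)$, $g(t)\to\infty$ as $t\to\infty$, $g$ absolutely continuous on bounded subintervals of $[0,\infty)$, and $$\lambda\le \frac{t g'(t)}{g(t)}\le\Lambda\qquad\text{for a.e. } t>0 .$$ Put $G(t)=\int_0^{t} g(\tau)\,d\tau$, $D_su(x,y)=\dfrac{u(x)-u(y)}{|x-y|^s}$ and $d\mu=\dfrac{dx\,dy}{|x-y|^n}$ on $\mathbb R^n\times\mathbb R^n$. For a bounded open set $\Omega\subset\mathbb R^n$ let $W^{s,G}_0(\Omega)$ be the set of measurable $u\colon\mathbb R^n\to\mathbb R$ with $\int_{\mathbb R^n}G(|u|)\,dx<\infty$, $\iint G(|D_su|)\,d\mu<\infty$ and $u=0$ a.e. in $\mathbb R^n\setminus\Omega$. Let $K>0$ and let $u\in W^{s,G}_0(\Omega)$ be a weak solution of $|(-\Delta_g)^su|\le K$ in $\Omega$, that is, $$-K\int_\Omega\varphi\,dx\;\le\;\iint_{\mathbb R^n\times\mathbb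 R^n} g(D_su)\,D_s\varphi\,d\mu\;\le\; K\int_\Omega\varphi\,dx$$ for every $\varphi\in W^{s,G}_0(\Omega)$ with $\varphi\ge0$ a.e. in $\Omega$. Then $$\|u\|_{L^\infty(\mathbb R^n)}\le C,$$ where $C>0$ depends only on $s$, $n$, $\lambda$, $\Lambda$, $K$, $\operatorname{diam}(\Omega)$ and the value $g(1)$. In particular, if $g$ is normalized by $g(1)=1$, then $C$ depends only on $s,n,\lambda,\Lambda,K$ and $\operatorname{diam}(\Omega)$. -/

import Mathlib

open MeasureTheory Set Filter Topology

noncomputable section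

/-- The standing assumptions on the density `g = G'` of the Young function, with ellipticity
constants `1 < lam ≤ Lam < ∞`. The function `g` is given on `[0, ∞)` and extended to `ℝ` oddly;
it is positive, nondecreasing and convex on `(0, ∞)`, unbounded, absolutely continuous (on every
bounded interval `[0, T]`), and satisfies `lam ≤ t g'(t) / g(t) ≤ Lam` at almost every `t > 0`. -/
structure IsYoungDensity (g : ℝ → ℝ) (lam Lam : ℝ) : Prop where
  odd : ∀ t, g (-t) = -g t
  pos : ∀ t, 0 < t → 0 < g t
  monotoneOn : MonotoneOn g (Ioi 0)
  tendsto_atTop : Tendsto g atTop atTop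
  convexOn : ConvexOn ℝ (Ioi 0) g
  absolutelyContinuous : ∀ T, 0 < T → AbsolutelyContinuousOnInterval g 0 T
  one_lt : 1 < lam
  growth : ∀ᵐ t ∂(volume.restrict (Ioi (0 : ℝ))),
    lam ≤ t * deriv g t / g t ∧ t * deriv g t / g t ≤ Lam

/-- The Young function `G(t) = ∫₀ᵗ g` (an even function on `ℝ`, as `g` is odd). -/
def youngFunction (g : ℝ → ℝ) (t : ℝ) : ℝ :=
  ∫ τ in (0 : ℝ)..t, g τ

/-- The measure `dμ = dx dy / |x - y|ⁿ` on `ℝⁿ × ℝⁿ`. -/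
def kernelMeasure (n : ℕ) :
    Measure (EuclideanSpace ℝ (Fin n) × EuclideanSpace ℝ (Fin n)) :=
  (volume.prod volume).withDensity fun p => ENNReal.ofReal ((‖p.1 - p.2‖ ^ n)⁻¹)

/-- The `s`-Hölder quotient `D_s u (x, y) = (u(x) - u(y)) / |x - y|ˢ`. -/
def holderQuotient {n : ℕ} (s : ℝ) (u : EuclideanSpace ℝ (Fin n) → ℝ)
    (p : EuclideanSpace ℝ (Fin n) × EuclideanSpace ℝ (Fin n)) : ℝ :=
  (u p.1 - u p.2) / ‖p.1 - p.2‖ ^ s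

/-- The fractional Orlicz-Sobolev space `W^{s,G}(ℝⁿ)`: measurable `u` with
`∫ G(|u|) dx < ∞` and `∬ G(|D_s u|) dμ < ∞`. -/
def fracOrliczSobolev {n : ℕ} (g : ℝ → ℝ) (s : ℝ) : Set (EuclideanSpace ℝ (Fin n) → ℝ) :=
  {u | AEMeasurable u volume ∧
    ∫⁻ x, ENNReal.ofReal (youngFunction g |u x|) < ⊤ ∧
    ∫⁻ p, ENNReal.ofReal (youngFunction g |holderQuotient s u p|) ∂(kernelMeasure n) < ⊤}

/-- `W^{s,G}_0(Ω)`: the functions of `W^{s,G}(ℝⁿ)` vanishing a.e. outside `Ω`. -/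
def fracOrliczSobolevZero {n : ℕ} (g : ℝ → ℝ) (s : ℝ) (Ω : Set (EuclideanSpace ℝ (Fin n))) :
    Set (EuclideanSpace ℝ (Fin n) → ℝ) :=
  {u | u ∈ fracOrliczSobolev g s ∧ ∀ᵐ x, x ∉ Ω → u x = 0}

/-- The pairing `⟨(-Δ_g)ˢ u, φ⟩ = ∬ g(D_s u) D_s φ dμ` over `ℝⁿ × ℝⁿ`. For `u` and `φ` in
`W^{s,G}(ℝⁿ)` the integrand is integrable, by Young's inequality. -/
def fracGLaplacianPairing {n : ℕ} (g : ℝ → ℝ) (s : ℝ)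
    (u φ : EuclideanSpace ℝ (Fin n) → ℝ) : ℝ :=
  ∫ p, g (holderQuotient s u p) * holderQuotient s φ p ∂(kernelMeasure n)

/-- `u ∈ W^{s,G}_0(Ω)` is a weak subsolution of `(-Δ_g)ˢ u = f` in `Ω`. -/
def IsWeakSubsolution {n : ℕ} (g : ℝ → ℝ) (s : ℝ) (Ω : Set (EuclideanSpace ℝ (Fin n)))
    (u f : EuclideanSpace ℝ (Fin n) → ℝ) : Prop :=
  u ∈ fracOrliczSobolevZero g s Ω ∧
  ∀ φ ∈ fracOrliczSobolevZero g s Ω, (∀ᵐ x, x ∈ Ω → 0 ≤ φ x) →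
    fracGLaplacianPairing g s u φ ≤ ∫ x in Ω, f x * φ x

/-- `u` is a weak supersolution of `(-Δ_g)ˢ u = f` when `-u` is a weak subsolution of
`(-Δ_g)ˢ v = -f`. -/
def IsWeakSupersolution {n : ℕ} (g : ℝ → ℝ) (s : ℝ) (Ω : Set (EuclideanSpace ℝ (Fin n)))
    (u f : EuclideanSpace ℝ (Fin n) → ℝ) : Prop :=
  IsWeakSubsolution g s Ω (fun x => -u x) (fun x => -f x)

/-- `u` solves `|(-Δ_g)ˢ u| ≤ K` weakly in `Ω`, that is, `-K ≤ (-Δ_g)ˢ u ≤ K` weakly. -/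
def IsWeakSolutionAbsLe {n : ℕ} (g : ℝ → ℝ) (s : ℝ) (Ω : Set (EuclideanSpace ℝ (Fin n)))
    (u : EuclideanSpace ℝ (Fin n) → ℝ) (K : ℝ) : Prop :=
  IsWeakSubsolution g s Ω u (fun _ => K) ∧ IsWeakSupersolution g s Ω u (fun _ => -K)

end

/-! The bound comes from the nonlocality alone, with no iteration. Test the inequality with `φ = (u
- k)₊`, `k ≥ 0`: the pairing is at most `K ∫ φ`. The pairing integrand is nonnegative, so it may be
bounded below by keeping only pairs with `x ∈ {u > k}` and `y` in a unit ball `A` outside `Ω`, where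
`u = 0`. If `|x - y| ≤ R` there, the pairing is at least `c |A| ∫ φ` with `c = g (k / R^s) /
R^(s+n)` (`lintegral_pairing_posPart_ge`). Once `c |A| > K`, this forces `∫ φ = 0`, so `u ≤ k` a.e.
Convexity gives `g t ≥ g 1 * t` for `t ≥ 1`, which makes `k` explicit; `-u` is treated the same way.
-/

open MeasureTheory Set Filter Topology

/-! ### Growth of the Young density. -/

namespace IsYoungDensity

variable {g : ℝ → ℝ} {lam Lam : ℝ}

theorem map_zero (h : IsYoungDensity g lam Lam) : g 0 = 0 := by
  have := h.odd 0
  rw [neg_zero] at this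
  linarith

theorem nonneg (h : IsYoungDensity g lam Lam) {t : ℝ} (ht : 0 ≤ t) : 0 ≤ g t := by
  rcases ht.eq_or_lt with rfl | ht
  · exact h.map_zero.ge
  · exact (h.pos t ht).le

theorem nonpos (h : IsYoungDensity g lam Lam) {t : ℝ} (ht : t ≤ 0) : g t ≤ 0 := by
  have h1 := h.nonneg (neg_nonneg.2 ht)
  rw [h.odd] at h1
  linarith

theorem monotone (h : IsYoungDensity g lam Lam) : Monotone g := by
  intro a b hab
  rcases lt_or_ge 0 a with ha | ha
  · exact h.monotoneOn ha (ha.trans_le hab) hab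
  rcases le_or_gt 0 b with hb | hb
  · exact (h.nonpos ha).trans (h.nonneg hb)
  · have h1 := h.monotoneOn (mem_Ioi.2 (neg_pos.2 hb)) (mem_Ioi.2 (by linarith)) (neg_le_neg hab)
    rw [h.odd, h.odd] at h1
    linarith

theorem youngFunction_mono (h : IsYoungDensity g lam Lam) {a b : ℝ} (ha : 0 ≤ a) (hab : a ≤ b) :
    youngFunction g a ≤ youngFunction g b := by
  have h1 := intervalIntegral.integral_add_adjacent_intervals
    (h.monotone.intervalIntegrable (μ := volume) (a := 0) (b := a))
    (h.monotone.intervalIntegrable (μ := volume) (a := a) (b := b))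
  have h2 : 0 ≤ ∫ τ in a..b, g τ :=
    intervalIntegral.integral_nonneg hab fun x hx => h.nonneg (ha.trans hx.1)
  simp only [youngFunction]
  linarith

theorem youngFunction_nonneg (h : IsYoungDensity g lam Lam) {t : ℝ} (ht : 0 ≤ t) :
    0 ≤ youngFunction g t :=
  intervalIntegral.integral_nonneg ht fun _ hx => h.nonneg hx.1

/-- Integrate `τ g'(τ) ≤ Lam * g τ` over `[0, t]` and integrate the left side by parts. -/
theorem mul_self_le_youngFunction (h : IsYoungDensity g lam Lam) {t : ℝ} (ht : 0 ≤ t) :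
    t * g t ≤ (1 + Lam) * youngFunction g t := by
  rcases ht.eq_or_lt with rfl | ht
  · simp [youngFunction]
  have hac := h.absolutelyContinuous t ht
  have hid : AbsolutelyContinuousOnInterval (fun x : ℝ => x) 0 t :=
    (LipschitzWith.id.lipschitzOnWith (s := uIcc 0 t)).absolutelyContinuousOnInterval
  have parts := hid.integral_mul_deriv_eq_deriv_mul hac
  have hle : ∫ x in (0 : ℝ)..t, x * deriv g x ≤ ∫ x in (0 : ℝ)..t, Lam * g x := by
    refine intervalIntegral.integral_mono_ae_restrict ht.le
      (hac.intervalIntegrable_deriv.continuousOn_mul continuousOn_id)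
      (h.monotone.intervalIntegrable.const_mul Lam) ?_
    rw [← restrict_Ioc_eq_restrict_Icc]
    filter_upwards [ae_restrict_of_ae_restrict_of_subset Ioc_subset_Ioi_self h.growth,
      ae_restrict_mem measurableSet_Ioc] with x hx hx0
    exact (div_le_iff₀ (h.pos x hx0.1)).1 hx.2
  simp only [deriv_id'', one_mul, zero_mul, sub_zero] at parts
  rw [intervalIntegral.integral_const_mul] at hle
  simp only [youngFunction]
  linarith

theorem mul_le_of_one_le (h : IsYoungDensity g lam Lam) {t : ℝ} (ht : 1 ≤ t) : g 1 * t ≤ g t := by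
  have ht0 : 0 < t := by linarith
  rcases ht.eq_or_lt with rfl | ht1
  · simp
  -- Convexity is only given on the open half-line, so the chord runs from `ε` to `t` through `1`,
  -- and then `ε → 0`.
  have hcont : Tendsto g (𝓝[>] 0) (𝓝 0) := by
    have h1 := (h.absolutelyContinuous 1 one_pos).continuousOn 0 left_mem_uIcc
    rw [uIcc_of_le zero_le_one, ContinuousWithinAt, h.map_zero] at h1
    refine h1.mono_left ?_
    rw [← nhdsWithin_Ioc_eq_nhdsGT (zero_lt_one' ℝ)]
    exact nhdsWithin_mono _ Ioc_subset_Icc_self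
  have hid : Tendsto (fun ε : ℝ => ε) (𝓝[>] 0) (𝓝 0) := tendsto_id.mono_left nhdsWithin_le_nhds
  have hl : Tendsto (fun ε => g 1 * (t - ε)) (𝓝[>] 0) (𝓝 (g 1 * (t - 0))) :=
    (hid.const_sub t).const_mul _
  have hr : Tendsto (fun ε => g ε * (t - 1) + g t * (1 - ε)) (𝓝[>] 0)
      (𝓝 (0 * (t - 1) + g t * (1 - 0))) :=
    (hcont.mul_const _).add ((hid.const_sub 1).const_mul _)
  have key : g 1 * (t - 0) ≤ 0 * (t - 1) + g t * (1 - 0) := by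
    refine le_of_tendsto_of_tendsto hl hr ?_
    filter_upwards [Ioo_mem_nhdsGT (zero_lt_one' ℝ)] with ε hε
    have hd : 0 < t - ε := by linarith [hε.2]
    have hc := h.convexOn.2 (mem_Ioi.2 hε.1) (mem_Ioi.2 ht0)
      (div_nonneg (by linarith) hd.le : 0 ≤ (t - 1) / (t - ε))
      (div_nonneg (by linarith [hε.2]) hd.le : 0 ≤ (1 - ε) / (t - ε))
      (by field_simp; ring)
    have he : ((t - 1) / (t - ε)) • ε + ((1 - ε) / (t - ε)) • t = 1 := by
      simp only [smul_eq_mul]; field_simp; ring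
    rw [he, smul_eq_mul, smul_eq_mul] at hc
    have h2 := mul_le_mul_of_nonneg_right hc hd.le
    calc g 1 * (t - ε) ≤ _ := h2
      _ = _ := by field_simp
  linarith

end IsYoungDensity

/-! ### Testing with truncations. -/

section Pairing

variable {n : ℕ} {g : ℝ → ℝ} {lam Lam s : ℝ} {u φ : EuclideanSpace ℝ (Fin n) → ℝ}

theorem measurable_kernel :
    Measurable fun p : EuclideanSpace ℝ (Fin n) × EuclideanSpace ℝ (Fin n) =>
      ENNReal.ofReal ((‖p.1 - p.2‖ ^ n)⁻¹) := by
  fun_prop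

theorem aemeasurable_holderQuotient (hu : AEMeasurable u volume) :
    AEMeasurable (holderQuotient s u) (volume.prod volume) := by
  have h1 : AEMeasurable
      (fun p : EuclideanSpace ℝ (Fin n) × EuclideanSpace ℝ (Fin n) => u p.1)
      (volume.prod volume) := hu.comp_quasiMeasurePreserving Measure.quasiMeasurePreserving_fst
  have h2 : AEMeasurable
      (fun p : EuclideanSpace ℝ (Fin n) × EuclideanSpace ℝ (Fin n) => u p.2)
      (volume.prod volume) := hu.comp_quasiMeasurePreserving Measure.quasiMeasurePreserving_snd
  have h3 : Measurable
      (fun p : EuclideanSpace ℝ (Fin n) × EuclideanSpace ℝ (Fin n) => ‖p.1 - p.2‖ ^ s) :=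
    (by fun_prop : Measurable fun p : EuclideanSpace ℝ (Fin n) × EuclideanSpace ℝ (Fin n) =>
      ‖p.1 - p.2‖).pow_const s
  exact (h1.sub h2).div h3.aemeasurable

theorem abs_holderQuotient_posPart_le (k : ℝ)
    (p : EuclideanSpace ℝ (Fin n) × EuclideanSpace ℝ (Fin n)) :
    |holderQuotient s (fun x => max (u x - k) 0) p| ≤ |holderQuotient s u p| := by
  simp only [holderQuotient, abs_div]
  refine div_le_div_of_nonneg_right ?_ (abs_nonneg _)
  refine (abs_max_sub_max_le_abs _ _ _).trans_eq ?_
  congr 1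
  ring

theorem IsYoungDensity.holderQuotient_mul_posPart_nonneg (hg : IsYoungDensity g lam Lam) (k : ℝ)
    (p : EuclideanSpace ℝ (Fin n) × EuclideanSpace ℝ (Fin n)) :
    0 ≤ g (holderQuotient s u p) * holderQuotient s (fun x => max (u x - k) 0) p := by
  have hr : 0 ≤ ‖p.1 - p.2‖ ^ s := by positivity
  rcases le_total (u p.2) (u p.1) with h | h
  · refine mul_nonneg (hg.nonneg (div_nonneg (by linarith) hr)) (div_nonneg ?_ hr)
    exact sub_nonneg.2 (max_le_max_right _ (by linarith))
  · refine mul_nonneg_of_nonpos_of_nonpos (hg.nonpos (div_nonpos_of_nonpos_of_nonneg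
      (by linarith) hr)) (div_nonpos_of_nonpos_of_nonneg ?_ hr)
    exact sub_nonpos.2 (max_le_max_right _ (by linarith))

theorem IsYoungDensity.posPart_mem_fracOrliczSobolevZero (hg : IsYoungDensity g lam Lam)
    {Ω : Set (EuclideanSpace ℝ (Fin n))} (hu : u ∈ fracOrliczSobolevZero g s Ω)
    {k : ℝ} (hk : 0 ≤ k) : (fun x => max (u x - k) 0) ∈ fracOrliczSobolevZero g s Ω := by
  obtain ⟨⟨hm, h1, h2⟩, h0⟩ := hu
  refine ⟨⟨(hm.sub_const k).max aemeasurable_const, lt_of_le_of_lt (lintegral_mono fun x => ?_) h1,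
    lt_of_le_of_lt (lintegral_mono fun p => ?_) h2⟩, ?_⟩
  · refine ENNReal.ofReal_le_ofReal (hg.youngFunction_mono (abs_nonneg _) ?_)
    rw [abs_of_nonneg (le_max_right _ _)]
    exact max_le (by linarith [le_abs_self (u x)]) (abs_nonneg _)
  · exact ENNReal.ofReal_le_ofReal
      (hg.youngFunction_mono (abs_nonneg _) (abs_holderQuotient_posPart_le k p))
  · filter_upwards [h0] with x hx hxΩ
    rw [hx hxΩ, max_eq_right (by linarith)]

/-- The integrand is dominated by `|D_s u| g(|D_s u|) ≤ (1 + Lam) G(|D_s u|)`. Integrability lets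
the Bochner pairing, which would be `0` by default otherwise, be identified with a lower integral.
-/
theorem IsYoungDensity.integrable_pairing (hg : IsYoungDensity g lam Lam)
    (hu : u ∈ fracOrliczSobolev g s) (hφ : AEMeasurable φ volume)
    (hle : ∀ p, |holderQuotient s φ p| ≤ |holderQuotient s u p|) :
    Integrable (fun p => g (holderQuotient s u p) * holderQuotient s φ p) (kernelMeasure n) := by
  obtain ⟨hm, -, h2⟩ := hu
  have hac : kernelMeasure n ≪ volume.prod volume := withDensity_absolutelyContinuous _ _
  have hQu : AEMeasurable (holderQuotient s u) (kernelMeasure n) :=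
    (aemeasurable_holderQuotient hm).mono_ac hac
  have hQφ : AEMeasurable (holderQuotient s φ) (kernelMeasure n) :=
    (aemeasurable_holderQuotient hφ).mono_ac hac
  have hGmeas : AEMeasurable (fun p => youngFunction g |holderQuotient s u p|)
      (kernelMeasure n) := by
    -- `G` is even, hence monotone only on `[0, ∞)`; truncating at `0` gives measurability.
    have hG : Monotone fun t => youngFunction g (max t 0) := fun a b hab =>
      hg.youngFunction_mono (le_max_right _ _) (max_le_max_right _ hab)
    have := hG.measurable.comp_aemeasurable hQu.abs
    refine this.congr (ae_of_all _ fun p => ?_)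
    simp
  have hG : Integrable (fun p => youngFunction g |holderQuotient s u p|) (kernelMeasure n) := by
    refine ⟨hGmeas.aestronglyMeasurable, ?_⟩
    rw [hasFiniteIntegral_iff_ofReal
      (ae_of_all _ fun p => hg.youngFunction_nonneg (abs_nonneg _))]
    exact h2
  refine (hG.const_mul (1 + Lam)).mono'
    ((hg.monotone.measurable.comp_aemeasurable hQu).mul hQφ).aestronglyMeasurable
    (ae_of_all _ fun p => ?_)
  refine le_trans ?_ (hg.mul_self_le_youngFunction (abs_nonneg _))
  have habs : |g (holderQuotient s u p)| = g |holderQuotient s u p| := by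
    rcases le_total 0 (holderQuotient s u p) with h | h
    · rw [abs_of_nonneg h, abs_of_nonneg (hg.nonneg h)]
    · rw [abs_of_nonpos h, abs_of_nonpos (hg.nonpos h), hg.odd]
  rw [Real.norm_eq_abs, abs_mul, habs, mul_comm]
  exact mul_le_mul_of_nonneg_right (hle p) (hg.nonneg (abs_nonneg _))

/-- The interaction of `{u > k}` with a set `A` outside `Ω`, at distance at most `R` from `Ω`,
bounds the pairing of `u` with `(u - k)₊` from below. -/
theorem IsYoungDensity.lintegral_pairing_posPart_ge (hg : IsYoungDensity g lam Lam) (hs : 0 ≤ s)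
    {Ω A : Set (EuclideanSpace ℝ (Fin n))} (hu : u ∈ fracOrliczSobolevZero g s Ω)
    (hA : MeasurableSet A) (hAΩ : Disjoint A Ω) {R : ℝ} (hR : 0 < R)
    (hdist : ∀ x ∈ Ω, ∀ y ∈ A, ‖x - y‖ ≤ R) {k : ℝ} (hk : 0 ≤ k) :
    ENNReal.ofReal (g (k / R ^ s) / R ^ s / R ^ n) * volume A *
        ∫⁻ x, ENNReal.ofReal (max (u x - k) 0) ≤
      ∫⁻ p, ENNReal.ofReal
        (g (holderQuotient s u p) * holderQuotient s (fun x => max (u x - k) 0) p)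
          ∂(kernelMeasure n) := by
  obtain ⟨⟨hm, -, -⟩, h0⟩ := hu
  set φ : EuclideanSpace ℝ (Fin n) → ℝ := fun x => max (u x - k) 0 with hφdef
  have hφ : AEMeasurable φ volume := (hm.sub_const k).max aemeasurable_const
  set c := g (k / R ^ s) / R ^ s / R ^ n with hc
  have hRs : 0 < R ^ s := Real.rpow_pos_of_pos hR s
  have hc0 : 0 ≤ c :=
    div_nonneg (div_nonneg (hg.nonneg (div_nonneg hk hRs.le)) hRs.le) (pow_pos hR n).le
  have hF : AEMeasurable (fun p => ENNReal.ofReal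
      (g (holderQuotient s u p) * holderQuotient s φ p)) (volume.prod volume) :=
    ((hg.monotone.measurable.comp_aemeasurable (aemeasurable_holderQuotient hm)).mul
      (aemeasurable_holderQuotient hφ)).ennreal_ofReal
  rw [kernelMeasure, lintegral_withDensity_eq_lintegral_mul₀ measurable_kernel.aemeasurable hF]
  have hprod : ENNReal.ofReal c * volume A * ∫⁻ x, ENNReal.ofReal (φ x) =
      ∫⁻ p, (ENNReal.ofReal c * ENNReal.ofReal (φ p.1)) * A.indicator 1 p.2
        ∂((volume : Measure (EuclideanSpace ℝ (Fin n))).prod volume) := by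
    rw [lintegral_prod_mul (f := fun x => ENNReal.ofReal c * ENNReal.ofReal (φ x))
      (g := A.indicator 1) (hφ.ennreal_ofReal.const_mul _)
      (measurable_one.indicator hA).aemeasurable, lintegral_const_mul'' _ hφ.ennreal_ofReal,
      lintegral_indicator_one hA]
    ring
  rw [hprod]
  refine lintegral_mono_ae ?_
  filter_upwards [Measure.quasiMeasurePreserving_fst.ae h0,
    Measure.quasiMeasurePreserving_snd.ae h0] with p hp1 hp2
  obtain ⟨x, y⟩ := p
  simp only [Pi.mul_apply] at hp1 hp2 ⊢
  by_cases hy : y ∈ A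
  swap
  · simp [hy]
  rcases le_or_gt (u x) k with hx | hx
  · simp [hφdef, hx]
  have hxΩ : x ∈ Ω := by
    by_contra hx'
    linarith [hp1 hx']
  have hyΩ : y ∉ Ω := fun h => hAΩ.le_bot ⟨hy, h⟩
  have huy : u y = 0 := hp2 hyΩ
  -- As `x ∈ Ω` and `y ∉ Ω`, the pair is off the diagonal, so replacing `‖x - y‖` by `R` only lowers
  -- each factor.
  have hr : 0 < ‖x - y‖ := norm_pos_iff.2 (sub_ne_zero.2 fun h => hyΩ (h ▸ hxΩ))
  have hrR := hdist x hxΩ y hy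
  have hrs : 0 < ‖x - y‖ ^ s := Real.rpow_pos_of_pos hr s
  have hrsR : ‖x - y‖ ^ s ≤ R ^ s := Real.rpow_le_rpow hr.le hrR hs
  have hφx : φ x = u x - k := max_eq_left (by linarith)
  have hφy : φ y = 0 := by simp [hφdef, huy, hk]
  rw [indicator_of_mem hy, Pi.one_apply, mul_one, ← ENNReal.ofReal_mul hc0,
    ← ENNReal.ofReal_mul (by positivity)]
  refine ENNReal.ofReal_le_ofReal ?_
  simp only [holderQuotient, huy, hφx, hφy, sub_zero]
  have hgle : g (k / R ^ s) ≤ g (u x / ‖x - y‖ ^ s) :=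
    hg.monotone (div_le_div₀ (by linarith) hx.le hrs hrsR)
  have hg0 : 0 ≤ g (k / R ^ s) := hg.nonneg (div_nonneg hk hRs.le)
  have hb : (u x - k) / R ^ s ≤ (u x - k) / ‖x - y‖ ^ s :=
    div_le_div_of_nonneg_left (by linarith) hrs hrsR
  have hinv : (R ^ n)⁻¹ ≤ (‖x - y‖ ^ n)⁻¹ :=
    inv_anti₀ (pow_pos hr n) (pow_le_pow_left₀ hr.le hrR n)
  calc c * (u x - k) = (R ^ n)⁻¹ * (g (k / R ^ s) * ((u x - k) / R ^ s)) := by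
        rw [hc]; field_simp
    _ ≤ _ := mul_le_mul hinv
        (mul_le_mul hgle hb (div_nonneg (by linarith) hRs.le) (hg0.trans hgle))
        (mul_nonneg hg0 (div_nonneg (by linarith) hRs.le)) (by positivity)

theorem IsYoungDensity.ae_le_of_isWeakSubsolution (hg : IsYoungDensity g lam Lam) (hs : 0 ≤ s)
    {Ω A : Set (EuclideanSpace ℝ (Fin n))} {K : ℝ} (hK : 0 ≤ K)
    (hu : IsWeakSubsolution g s Ω u fun _ => K)
    (hA : MeasurableSet A) (hAΩ : Disjoint A Ω) {R : ℝ} (hR : 0 < R)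
    (hdist : ∀ x ∈ Ω, ∀ y ∈ A, ‖x - y‖ ≤ R) {k : ℝ} (hk : 0 ≤ k)
    (hlarge : ENNReal.ofReal K < ENNReal.ofReal (g (k / R ^ s) / R ^ s / R ^ n) * volume A) :
    ∀ᵐ x, u x ≤ k := by
  obtain ⟨hmem, hsub⟩ := hu
  have hlow := hg.lintegral_pairing_posPart_ge hs hmem hA hAΩ hR hdist hk
  have hφmem := hg.posPart_mem_fracOrliczSobolevZero hmem hk
  set φ : EuclideanSpace ℝ (Fin n) → ℝ := fun x => max (u x - k) 0 with hφdef
  have hφ0 : ∀ x, 0 ≤ φ x := fun x => le_max_right _ _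
  have hφm : AEMeasurable φ volume := hφmem.1.1
  have hint := hg.integrable_pairing hmem.1 hφm
    (fun p => abs_holderQuotient_posPart_le k p)
  have hpair := hsub φ hφmem (ae_of_all _ fun x _ => hφ0 x)
  rw [← ofReal_integral_eq_lintegral_ofReal hint
    (ae_of_all _ fun p => hg.holderQuotient_mul_posPart_nonneg k p)] at hlow
  set I := ∫⁻ x, ENNReal.ofReal (φ x) with hI
  set M := ENNReal.ofReal (g (k / R ^ s) / R ^ s / R ^ n) * volume A with hM
  have hup : ENNReal.ofReal (fracGLaplacianPairing g s u φ) ≤ ENNReal.ofReal K * I := by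
    refine (ENNReal.ofReal_le_ofReal hpair).trans ?_
    rw [integral_eq_lintegral_of_nonneg_ae (ae_of_all _ fun x => mul_nonneg hK (hφ0 x))
      (hφm.restrict.const_mul K).aestronglyMeasurable]
    refine ENNReal.ofReal_toReal_le.trans ((setLIntegral_le_lintegral _ _).trans_eq ?_)
    simp only [ENNReal.ofReal_mul hK]
    exact lintegral_const_mul'' _ hφm.ennreal_ofReal
  have hMI : M * I ≤ ENNReal.ofReal K * I := hlow.trans hup
  have hM0 : M ≠ 0 := (pos_of_gt hlarge).ne'
  -- Finiteness of `∫ φ`, needed to cancel it, follows from the lower bound, since the pairing is a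
  -- real number.
  have hItop : I ≠ ⊤ := by
    intro h
    rw [h, ENNReal.mul_top hM0] at hlow
    exact ENNReal.ofReal_ne_top (top_le_iff.1 hlow)
  have hI0 : I = 0 := by
    by_contra h
    exact absurd ((ENNReal.mul_le_mul_iff_left h hItop).1 hMI) hlarge.not_ge
  rw [hI, lintegral_eq_zero_iff' hφm.ennreal_ofReal] at hI0
  filter_upwards [hI0] with x hx
  have h1 : φ x ≤ 0 := ENNReal.ofReal_eq_zero.1 hx
  linarith [le_max_left (u x - k) 0]

end Pairing

/-! ### The exterior ball and the final constant. -/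

theorem exists_ball_disjoint_of_diam_eq {n : ℕ} (hn : 1 ≤ n) {Ω : Set (EuclideanSpace ℝ (Fin n))}
    (hb : Bornology.IsBounded Ω) (hne : Ω.Nonempty) :
    ∃ p, Disjoint (Metric.ball p 1) Ω ∧
      ∀ x ∈ Ω, ∀ y ∈ Metric.ball p 1, ‖x - y‖ ≤ 2 * Metric.diam Ω + 3 := by
  obtain ⟨x₀, hx₀⟩ := hne
  set d := Metric.diam Ω
  have hd : 0 ≤ d := Metric.diam_nonneg
  -- At centre distance `d + 2` from `x₀`, the unit ball stays farther than `d` from `x₀`, so it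
  -- misses `Ω`; distances to `Ω` are at most `d + (d + 2) + 1`.
  refine ⟨x₀ + EuclideanSpace.single (⟨0, hn⟩ : Fin n) (d + 2), ?_, ?_⟩
  · rw [Set.disjoint_left]
    intro y hy hyΩ
    have h1 := Metric.dist_le_diam_of_mem hb hyΩ hx₀
    have h2 := Metric.mem_ball.1 hy
    have h3 := dist_triangle_left (x₀ + EuclideanSpace.single (⟨0, hn⟩ : Fin n) (d + 2)) x₀ y
    have h4 : dist (x₀ + EuclideanSpace.single (⟨0, hn⟩ : Fin n) (d + 2)) x₀ = d + 2 := by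
      rw [dist_eq_norm, add_sub_cancel_left, PiLp.norm_single, Real.norm_eq_abs,
        abs_of_nonneg (by linarith)]
    linarith
  · intro x hx y hy
    have h1 := Metric.dist_le_diam_of_mem hb hx hx₀
    have h2 := Metric.mem_ball.1 hy
    have h4 : dist x₀ (x₀ + EuclideanSpace.single (⟨0, hn⟩ : Fin n) (d + 2)) = d + 2 := by
      rw [dist_eq_norm, sub_add_cancel_left, norm_neg, PiLp.norm_single,
        Real.norm_eq_abs, abs_of_nonneg (by linarith)]
    have h5 := dist_triangle4 x x₀ (x₀ + EuclideanSpace.single (⟨0, hn⟩ : Fin n) (d + 2)) y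
    rw [dist_comm y] at h2
    rw [← dist_eq_norm]
    linarith

theorem proposition4p7 (n : ℕ) (hn : 1 ≤ n) (s : ℝ) (hs0 : 0 < s) (hs1 : s < 1)
    (lam Lam : ℝ) (K : ℝ) (hK : 0 < K) (d γ : ℝ) :
    ∃ C : ℝ, 0 < C ∧
      ∀ g : ℝ → ℝ, IsYoungDensity g lam Lam → g 1 = γ →
      ∀ Ω : Set (EuclideanSpace ℝ (Fin n)), IsOpen Ω → Bornology.IsBounded Ω →
        Metric.diam Ω = d →
      ∀ u ∈ fracOrliczSobolevZero g s Ω, IsWeakSolutionAbsLe g s Ω u K →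
        eLpNorm u ⊤ volume ≤ ENNReal.ofReal C := by
  rcases le_or_gt γ 0 with hγ | hγ
  · exact ⟨1, one_pos, fun g hg h1 => absurd (h1 ▸ hg.pos 1 one_pos) hγ.not_gt⟩
  rcases lt_or_ge d 0 with hd | hd
  · exact ⟨1, one_pos, fun g _ _ Ω _ _ hdiam => absurd Metric.diam_nonneg (by
      rw [hdiam]; exact hd.not_ge)⟩
  set R := 2 * d + 3 with hRdef
  have hR : 0 < R := by linarith
  have hRs : 0 < R ^ s := Real.rpow_pos_of_pos hR s
  set v := volume.real (Metric.ball (0 : EuclideanSpace ℝ (Fin n)) 1) with hv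
  have hv0 : 0 < v :=
    ENNReal.toReal_pos (Metric.measure_ball_pos _ _ one_pos).ne' measure_ball_lt_top.ne
  set a := v / R ^ s / R ^ n with ha
  have ha0 : 0 < a := by positivity
  set t := 1 + K / (a * γ) with ht
  have ht1 : 1 ≤ t := by
    have : 0 < K / (a * γ) := by positivity
    linarith
  -- `t` is chosen so that `a γ t = a γ + K > K`; the level `k = t * R ^ s` makes `k / R ^ s = t`.
  have ht0 : 0 < t := by linarith
  refine ⟨t * R ^ s, by positivity, fun g hg h1 Ω hΩ hb hdiam u hu hsol => ?_⟩
  have key : ∀ w, IsWeakSubsolution g s Ω w (fun _ => K) → ∀ᵐ x, w x ≤ t * R ^ s := by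
    intro w hw
    rcases Ω.eq_empty_or_nonempty with rfl | hne
    · filter_upwards [hw.1.2] with x hx
      rw [hx (notMem_empty x)]
      positivity
    obtain ⟨p, hdisj, hdist⟩ := exists_ball_disjoint_of_diam_eq hn hb hne
    rw [hdiam] at hdist
    refine hg.ae_le_of_isWeakSubsolution hs0.le hK.le hw measurableSet_ball hdisj hR hdist
      (by positivity) ?_
    have hvol : volume (Metric.ball p 1) = ENNReal.ofReal v := by
      rw [Measure.addHaar_ball_center, hv, ofReal_measureReal measure_ball_lt_top.ne]
    have hgt : γ * t ≤ g t := h1 ▸ hg.mul_le_of_one_le ht1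
    rw [mul_div_cancel_right₀ _ hRs.ne', hvol, ← ENNReal.ofReal_mul (div_nonneg (div_nonneg
      (hg.nonneg ht0.le) hRs.le) (by positivity))]
    refine (ENNReal.ofReal_lt_ofReal_iff_of_nonneg hK.le).2 ?_
    calc K < a * γ + K := by linarith [mul_pos ha0 hγ]
      _ = a * (γ * t) := by rw [ht]; field_simp
      _ ≤ a * g t := mul_le_mul_of_nonneg_left hgt ha0.le
      _ = g t / R ^ s / R ^ n * v := by rw [ha]; ring
  have hneg : IsWeakSubsolution g s Ω (fun x => -u x) (fun _ => K) := by
    simpa only [IsWeakSupersolution, neg_neg] using hsol.2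
  rw [eLpNorm_exponent_top]
  refine eLpNormEssSup_le_of_ae_bound ?_
  filter_upwards [key u hsol.1, key _ hneg] with x hx1 hx2
  exact abs_le.2 ⟨by linarith, hx1⟩
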